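/- Let $G$ be a finite abelian group and $H\le G$ a subgroup (in particular one may take a chain $1<H<G$). Write $\hat G=\mathrm{Hom}(G,\mathbb C^\times)$, fix isomorphisms $\varphi:G\to\hat G$ and $\psi:H\to\hat H$, and let $\pi:G\to H$ be the composite $\psi^{-1}\circ\mathrm{res}\circ\varphi$, where $\mathrm{res}:\hat G\to\hat H$ is restriction of characters. Products of subsets are $AB=\{ab\mid a\in A,\ b\in B\}$. Let $\mathbb Q(\tilde H)$ be the $\mathbb Q$-algebra with basis $\chi_B$, $\emptyset\ne B\subseteq H$, and product $\chi_B\chi_C=\chi_{BC}$. Let $\mathbb Q(H<G)$ be the commutative $\mathbb Q$-algebra with basis the elements $\chi_{(A,\pi(A))}$ ($\emptyset\neq A\subseteq G$) and $\chi_{(\emptyset,B)}$ ($\emptyset\ne B\subseteq H$), with products $$\chi_{(A,\pi(A))}\chi_{(B,\pi(B))}=\chi_{(AB,\pi(AB))}+\sum_{c\in\pi(AB)}(n_c-1)\chi_{(\emptyset,\{c\})},\quad \chi_{(A,\pi(A))}\chi_{(\emptyset,B)}=\sum_{h\in\pi(A)}\chi_{(\emptyset,hB)},\quad \chi_{(\emptyset,B)}\chi_{(\emptyset,C)}=\chi_{(\emptyset,BC)},$$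 where $n_c$ is the number of pairs $(h,h')\in\pi(A)\times\pi(B)$ with $hh'=c$; its unit element is $\chi_{(\{1\},\{1\})}$. (These are the rational generalized character rings of the irreducible glider representations for the chains $1<H$ and $1<H<G$, modulo the zero elements $\chi_\emptyset$ and $\chi_{(\emptyset,\emptyset)}$.) The element $e=\chi_{(\emptyset,\{1\})}$ is a central idempotent. Put $T=\mathbb Q(H<G)(1-e)$, a ring with unit element $1-e$, and $f:\mathbb Q(H<G)\to T$, $f(x)=x(1-e)$. 1. There is a ring isomorphism $\mathbb Q(H<G)\cong T\times\mathbb Q(\tilde H)$ with first component $f$, given by $$\chi_{(A,\pi(A))}\mapsto\Big(\chi_{(A,\pi(A))}-\sum_{h\in\pi(A)}\chi_{(\emptyset,\{h\})},\ \sum_{h\in\pi(A)}\chi_{\{h\}}\Big),\qquad \chi_{(\emptyset,B)}\mapsto(0,\chi_B).$$ 2. For every nonempty $A\subseteq G$ exactly one subgroup of $G$ occurs among the powers $A,A^2,A^3,\dots$; call it $n(A)$. For every $g\in A$ one has $A\subseteq g\,n(A)$, and $f(\chi_{(A,\pi(A))})-f(\chi_{(g\,n(A),\pi(g\,n(A)))})$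 is nilpotent. The ideal $I$ of $T$ generated by all these elements is nilpotent. 3. There is an isomorphism of rings $$\bigoplus_{N\le G}\mathbb Q(G/N)\ \longrightarrow\ T/I,$$ where $N$ runs over all subgroups of $G$, including $G$ itself, and $\mathbb Q(G/N)$ is the rational group algebra. It sends the unit element $e_N$ of $\mathbb Q(G/N)$, for $N\ne G$, to the class of $$\prod_{N'}\big(f(\chi_{(N,\pi(N))})-f(\chi_{(N',\pi(N'))})\big),$$ where $N'$ runs over the subgroups of $G$ containing $N$ for which $N'/N$ is a minimal nontrivial subgroup of $G/N$; and it sends $e_G$ to the class of $f(\chi_{(G,\pi(G))})$. -/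

import Mathlib

open scoped Pointwise

noncomputable section

namespace Glider

/-- The commutative monoid of nonempty finite subsets of a commutative group, with product
`A * B = {a * b | a ∈ A, b ∈ B}`. (If the group is finite, these are all nonempty subsets.) -/
def NE (G : Type*) [CommGroup G] [DecidableEq G] : Submonoid (Finset G) where
  carrier := {A | A.Nonempty}
  mul_mem' := fun hA hB => Finset.Nonempty.mul hA hB
  one_mem' := Finset.one_nonempty

section Subsets

variable {G : Type*} [CommGroup G] [DecidableEq G]

/-- The one-point subset `{g}`. -/
def pt (g : G) : NE G := ⟨{g}, Finset.singleton_nonempty g⟩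

/-- The coset `gN` of a subgroup `N` of a finite group, as a nonempty subset. -/
def coset [Finite G] (g : G) (N : Subgroup G) : NE G :=
  ⟨(Set.toFinite (g • (N : Set G))).toFinset,
    ⟨g, by simpa using Set.mem_smul_set.2 ⟨1, N.one_mem, by simp⟩⟩⟩

/-- `N = n(A)`: the subgroup `N` is one of the powers `A, A ^ 2, A ^ 3, …` of the subset `A`. -/
def IsPowerSubgroup (A : NE G) (N : Subgroup G) : Prop :=
  ∃ m : ℕ, 1 ≤ m ∧ (((A ^ m : NE G) : Finset G) : Set G) = N

end Subsets

/-- `ℚ(G̃)`, respectively `R(G̃)` for `k = ℤ`, for the chain `1 < G`, modulo the zero element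
`χ_∅`: the monoid algebra of the monoid of nonempty subsets of `G`. -/
abbrev SubsetAlgebra (k : Type*) [CommRing k] (G : Type*) [CommGroup G] [DecidableEq G] : Type _ :=
  MonoidAlgebra k (NE G)

/-- The homomorphism `π : G → H` obtained from isomorphisms `φ : G ≃ Ĝ` and `ψ : H ≃ Ĥ` with the
character groups as the composite `G → Ĝ → Ĥ → H`, the middle map being restriction. -/
def restrictionMap {G : Type*} [CommGroup G] (H : Subgroup G)
    (φ : G ≃* (G →* ℂˣ)) (ψ : H ≃* (H →* ℂˣ)) : G →* H :=
  ψ.symm.toMonoidHom.comp ((MonoidHom.compHom' H.subtype).comp φ.toMonoidHom)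

section Chain

variable {G H : Type*} [CommGroup G] [CommGroup H] [DecidableEq G] [DecidableEq H]

/-- The generalized character ring of the chain `1 < H < G` with coefficients in `k`, modulo the
zero element `χ_(∅,∅)`: the free `k`-module on the symbols `χ_(A,π(A))` (`Sum.inl A`, with
`∅ ≠ A ⊆ G`) and `χ_(∅,B)` (`Sum.inr B`, with `∅ ≠ B ⊆ H`). It is `R(H < G)` for `k = ℤ` and
`ℚ(H < G)` for `k = ℚ`; the multiplication, which involves `π`, is defined below. -/
@[nolint unusedArguments]
def ChainAlgebra (k : Type*) [CommRing k] (_ : G →* H) : Type _ :=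
  (NE G ⊕ NE H) →₀ k

variable (k : Type*) [CommRing k] (π : G →* H)

instance : AddCommGroup (ChainAlgebra k π) := inferInstanceAs (AddCommGroup ((NE G ⊕ NE H) →₀ k))

instance : Module k (ChainAlgebra k π) := inferInstanceAs (Module k ((NE G ⊕ NE H) →₀ k))

/-- The basis element `χ_(A,π(A))`, for `∅ ≠ A ⊆ G`. -/
def long (A : NE G) : ChainAlgebra k π := Finsupp.single (Sum.inl A) (1 : k)

/-- The basis element `χ_(∅,B)`, for `∅ ≠ B ⊆ H`. -/
def short (B : NE H) : ChainAlgebra k π := Finsupp.single (Sum.inr B) (1 : k)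

/-- `n_c`: the multiplicity of the irreducible representation `S_c` of `H` in
`(⨁_{h ∈ π(A)} S_h) ⊗ (⨁_{h' ∈ π(B)} S_h')`. -/
def mult (A B : NE G) (c : H) : ℕ :=
  (((A : Finset G).image π ×ˢ (B : Finset G).image π).filter fun p => p.1 * p.2 = c).card

/-- The products of two basis elements. -/
def basisMul : NE G ⊕ NE H → NE G ⊕ NE H → ChainAlgebra k π
  | Sum.inl A, Sum.inl B => long k π (A * B) +
      ∑ c ∈ ((A * B : NE G) : Finset G).image π, ((mult π A B c : k) - 1) • short k π (pt c)
  | Sum.inl A, Sum.inr B => ∑ h ∈ (A : Finset G).image π, short k π (pt h * B)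
  | Sum.inr B, Sum.inl A => ∑ h ∈ (A : Finset G).image π, short k π (pt h * B)
  | Sum.inr B, Sum.inr C => short k π (B * C)

/-- The bilinear extension of `basisMul`. -/
def mulLin : ChainAlgebra k π →ₗ[k] ChainAlgebra k π →ₗ[k] ChainAlgebra k π :=
  Finsupp.linearCombination k fun s => Finsupp.linearCombination k fun t => basisMul k π s t

instance : Mul (ChainAlgebra k π) := ⟨fun x y => mulLin k π x y⟩

instance : One (ChainAlgebra k π) := ⟨long k π 1⟩

theorem mul_def (x y : ChainAlgebra k π) : x * y = mulLin k π x y := rfl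

theorem mulLin_single (s t : NE G ⊕ NE H) :
    mulLin k π (Finsupp.single s (1 : k) : (NE G ⊕ NE H) →₀ k)
      (Finsupp.single t (1 : k) : (NE G ⊕ NE H) →₀ k) = basisMul k π s t := by
  unfold mulLin
  erw [Finsupp.linearCombination_single, one_smul, Finsupp.linearCombination_single, one_smul]

theorem long_mul_long (A B : NE G) : long k π A * long k π B = long k π (A * B) +
    ∑ c ∈ ((A * B : NE G) : Finset G).image π, ((mult π A B c : k) - 1) • short k π (pt c) :=
  mulLin_single k π (Sum.inl A) (Sum.inl B)

theorem long_mul_short (A : NE G) (B : NE H) : long k π A * short k π B =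
    ∑ h ∈ (A : Finset G).image π, short k π (pt h * B) :=
  mulLin_single k π (Sum.inl A) (Sum.inr B)

theorem short_mul_long (A : NE G) (B : NE H) : short k π B * long k π A =
    ∑ h ∈ (A : Finset G).image π, short k π (pt h * B) :=
  mulLin_single k π (Sum.inr B) (Sum.inl A)

theorem short_mul_short (B C : NE H) : short k π B * short k π C = short k π (B * C) :=
  mulLin_single k π (Sum.inr B) (Sum.inr C)

/-- Auxiliary: the sum of the one-point subsets contained in `π(A)`. -/
def pointSum (A : NE G) : SubsetAlgebra k H :=
  ∑ h ∈ (A : Finset G).image π, MonoidAlgebra.single (pt h) (1 : k)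

/-- Auxiliary linear map, used to verify the ring axioms. -/
def toProd : ChainAlgebra k π →ₗ[k] SubsetAlgebra k G × SubsetAlgebra k H :=
  Finsupp.linearCombination k (Sum.elim
    (fun A => (MonoidAlgebra.single A (1 : k), pointSum k π A))
    (fun B => (0, MonoidAlgebra.single B (1 : k))))

/-- Auxiliary linear map, used to verify the ring axioms. -/
def ofProd : SubsetAlgebra k G × SubsetAlgebra k H →ₗ[k] ChainAlgebra k π :=
  (Finsupp.linearCombination k
      (fun A => long k π A - ∑ h ∈ (A : Finset G).image π, short k π (pt h)) ∘ₗ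
    (MonoidAlgebra.coeffLinearEquiv k).toLinearMap ∘ₗ LinearMap.fst k _ _) +
  (Finsupp.linearCombination k (short k π) ∘ₗ
    (MonoidAlgebra.coeffLinearEquiv k).toLinearMap ∘ₗ LinearMap.snd k _ _)

theorem toProd_long (A : NE G) :
    toProd k π (long k π A) = (MonoidAlgebra.single A (1 : k), pointSum k π A) := by
  unfold toProd long
  erw [Finsupp.linearCombination_single]
  simp

theorem toProd_short (B : NE H) :
    toProd k π (short k π B) = (0, MonoidAlgebra.single B (1 : k)) := by
  unfold toProd short
  erw [Finsupp.linearCombination_single]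
  simp

theorem chain_hom_ext {M : Type*} [AddCommGroup M] [Module k M]
    {f g : ChainAlgebra k π →ₗ[k] M} (h1 : ∀ A, f (long k π A) = g (long k π A))
    (h2 : ∀ B, f (short k π B) = g (short k π B)) : f = g :=
  Finsupp.lhom_ext' (R := k) (M := k) (α := NE G ⊕ NE H) fun s => LinearMap.ext_ring (by
    cases s with
    | inl A => exact h1 A
    | inr B => exact h2 B)

theorem ofProd_single (A : NE G) (y : SubsetAlgebra k H) :
    ofProd k π (MonoidAlgebra.single A (1 : k), y) =
      long k π A - ∑ h ∈ (A : Finset G).image π, short k π (pt h) + ofProd k π (0, y) := by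
  simp [ofProd, MonoidAlgebra.coeffLinearEquiv]

theorem ofProd_snd (B : NE H) :
    ofProd k π (0, MonoidAlgebra.single B (1 : k)) = short k π B := by
  simp [ofProd, MonoidAlgebra.coeffLinearEquiv]

theorem ofProd_pointSum (A : NE G) :
    ofProd k π (0, pointSum k π A) = ∑ h ∈ (A : Finset G).image π, short k π (pt h) := by
  have : ((0, pointSum k π A) : SubsetAlgebra k G × SubsetAlgebra k H) =
      ∑ h ∈ (A : Finset G).image π, (0, MonoidAlgebra.single (pt h) (1 : k)) := by
    ext1 <;> simp [pointSum, Prod.fst_sum, Prod.snd_sum]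
  rw [this, map_sum]
  exact Finset.sum_congr rfl fun h _ => ofProd_snd k π _

theorem ofProd_comp_toProd : ofProd k π ∘ₗ toProd k π = LinearMap.id := by
  refine chain_hom_ext k π (fun A => ?_) (fun B => ?_)
  · rw [LinearMap.comp_apply, toProd_long, ofProd_single, ofProd_pointSum]
    simp
  · rw [LinearMap.comp_apply, toProd_short, ofProd_snd]
    rfl

theorem toProd_injective : Function.Injective (toProd k π) :=
  Function.LeftInverse.injective (g := ofProd k π)
    fun x => LinearMap.congr_fun (ofProd_comp_toProd k π) x

theorem image_mul_eq (A B : NE G) : ((A * B : NE G) : Finset G).image π =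
    (A : Finset G).image π * (B : Finset G).image π := by
  rw [Submonoid.coe_mul, Finset.image_mul]

theorem pt_mul_pt (a b : H) : pt a * pt b = pt (a * b) :=
  Subtype.ext (Finset.singleton_mul_singleton a b)

theorem pointSum_mul (A B : NE G) : pointSum k π A * pointSum k π B =
    ∑ c ∈ ((A * B : NE G) : Finset G).image π,
      (mult π A B c : k) • MonoidAlgebra.single (pt c) (1 : k) := by
  unfold pointSum
  rw [Finset.sum_mul_sum, ← Finset.sum_product', image_mul_eq]
  simp only [MonoidAlgebra.single_mul_single, mul_one, pt_mul_pt]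
  rw [← Finset.sum_fiberwise_of_maps_to
    (t := (A : Finset G).image π * (B : Finset G).image π) (g := fun p : H × H => p.1 * p.2)
    (fun p hp => Finset.mul_mem_mul (Finset.mem_product.1 hp).1 (Finset.mem_product.1 hp).2)]
  refine Finset.sum_congr rfl fun c _ => ?_
  rw [Finset.sum_congr rfl (g := fun _ => MonoidAlgebra.single (pt c) (1 : k))
    (fun p hp => by rw [(Finset.mem_filter.1 hp).2]), Finset.sum_const, Nat.cast_smul_eq_nsmul]
  rfl

theorem toProd_mul (x y : ChainAlgebra k π) :
    toProd k π (x * y) = toProd k π x * toProd k π y := by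
  have key : (mulLin k π).compr₂ (toProd k π) =
      (LinearMap.mul k (SubsetAlgebra k G × SubsetAlgebra k H)).compl₁₂
        (toProd k π) (toProd k π) := by
    refine chain_hom_ext k π (fun A => ?_) (fun B => ?_) <;>
    refine chain_hom_ext k π (fun A' => ?_) (fun B' => ?_) <;>
    simp only [LinearMap.compr₂_apply, LinearMap.compl₁₂_apply, LinearMap.mul_apply', ← mul_def,
      long_mul_long, long_mul_short, short_mul_long, short_mul_short, toProd_long, toProd_short,
      map_add, map_sum, map_smul, Prod.mk_mul_mk]
    · ext1
      · simp [Prod.fst_sum, MonoidAlgebra.single_mul_single]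
      · rw [pointSum_mul]
        simp [Prod.snd_sum, pointSum, sub_smul]
    · ext1
      · simp [Prod.fst_sum]
      · simp [Prod.snd_sum, pointSum, Finset.sum_mul, MonoidAlgebra.single_mul_single]
    · ext1
      · simp [Prod.fst_sum]
      · simp [Prod.snd_sum, pointSum, Finset.mul_sum, MonoidAlgebra.single_mul_single, mul_comm]
    · ext1 <;> simp [MonoidAlgebra.single_mul_single]
  exact LinearMap.congr_fun (LinearMap.congr_fun key x) y

theorem toProd_one : toProd k π 1 = 1 := by
  change toProd k π (long k π 1) = 1
  rw [toProd_long]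
  ext1
  · rfl
  · change pointSum k π 1 = 1
    rw [pointSum, show ((1 : NE G) : Finset G).image π = {1} by
      rw [Submonoid.coe_one, Finset.image_one, map_one], Finset.sum_singleton]
    rfl

instance : CommRing (ChainAlgebra k π) where
  __ := (inferInstance : AddCommGroup (ChainAlgebra k π))
  mul_assoc x y z := toProd_injective k π (by simp only [toProd_mul, mul_assoc])
  one_mul x := toProd_injective k π (by simp only [toProd_mul, toProd_one, one_mul])
  mul_one x := toProd_injective k π (by simp only [toProd_mul, toProd_one, mul_one])
  left_distrib x y z := map_add (mulLin k π x) y z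
  right_distrib x y z := by simp only [mul_def, map_add, LinearMap.add_apply]
  zero_mul x := by simp only [mul_def, map_zero, LinearMap.zero_apply]
  mul_zero x := map_zero (mulLin k π x)
  mul_comm x y := toProd_injective k π (by simp only [toProd_mul, mul_comm])

instance : Algebra k (ChainAlgebra k π) :=
  Algebra.ofModule (fun r x y => by simp only [mul_def, map_smul, LinearMap.smul_apply])
    (fun r x y => by simp only [mul_def, map_smul])

theorem isIdempotentElem_short_one : IsIdempotentElem (short k π 1) := by
  rw [IsIdempotentElem, short_mul_short, one_mul]

/-- The ring `T = A (1 - e)` with unit element `1 - e`, for `A` the algebra of the chain and `e`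
the central idempotent `χ_(∅,{1})`. (As `A` is commutative, `(1 - e) A (1 - e) = A (1 - e)`.) -/
abbrev Factor : Type _ :=
  IsIdempotentElem.Corner (R := ChainAlgebra k π) (isIdempotentElem_short_one k π).one_sub

/-- The projection `f : A → A (1 - e)`, `x ↦ x (1 - e)`. -/
def proj (x : ChainAlgebra k π) : Factor k π :=
  ⟨x * (1 - short k π 1), x, by
    change (1 - short k π 1) * x * (1 - short k π 1) = _
    rw [mul_comm (1 - short k π 1) x, mul_assoc, (isIdempotentElem_short_one k π).one_sub.eq]⟩

/-- The ideal `I` of `A (1 - e)` generated by the elements `f(χ_(A,π(A))) - f(χ_(gN,π(gN)))`,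
where `A` is a nonempty subset of `G`, `N = n(A)`, and `gN` is the coset of `N` containing `A`. -/
def nilIdeal [Finite G] : Ideal (Factor k π) :=
  Ideal.span {x | ∃ (A : NE G) (N : Subgroup G) (g : G), IsPowerSubgroup A N ∧
    (A : Finset G) ⊆ (coset g N : Finset G) ∧
    x = proj k π (long k π A) - proj k π (long k π (coset g N))}

end Chain

/-- The ring `⨁_{N ≤ G} ℚ(G/N)`, a finite product of rational group algebras. -/
abbrev SumQuotients (G : Type*) [CommGroup G] : Type _ :=
  ∀ N : Subgroup G, MonoidAlgebra ℚ (G ⧸ N)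

open Classical in
/-- The unit element `e_N` of the summand `ℚ(G/N)`. -/
def unitAt {G : Type*} [CommGroup G] (N : Subgroup G) : SumQuotients G := Pi.single N 1

end Glider

end

/-! The linear map `toProd` is a ring isomorphism of the chain algebra onto `ℚ[NE G] × ℚ[NE H]`, and
it sends `e` to `(0, 1)`. Hence `T` is the monoid algebra of `NE G` (`factorEquiv`), which gives the
splitting and turns the rest into a question about nonempty subsets of `G`.

Some positive power of `A` is idempotent, and an idempotent nonempty subset of a finite group is a
subgroup, namely `n(A)`. If `y` is the coset containing `x = A`, then `x * y = y * y` and some power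
of `x` equals that power of `y`, so `x - y` is nilpotent (`isNilpotent_sub_of_mul_eq`).

For each `N`, sending `A` to the coset of `N` that contains it, or to `0` if there is none, is
multiplicative. Together these characters map `ℚ[NE G]` to `⨁ ℚ(G/N)` and kill `I`. The products
over minimal overgroups hit the unit elements, so the map is onto. Modulo `I` the algebra is spanned
by cosets, at most as many as the dimension of the target, so the induced map is bijective
(`quotientHom_bijective`). -/

namespace Glider

/-! ### Powers of subsets and cosets -/

section Subsets

variable {G : Type*} [CommGroup G] [DecidableEq G]

theorem mem_mul_iff {A B : NE G} {x : G} :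
    x ∈ ((A * B : NE G) : Finset G) ↔ ∃ a ∈ (A : Finset G), ∃ b ∈ (B : Finset G), a * b = x := by
  rw [Submonoid.coe_mul, Finset.mem_mul]

theorem pow_mem_pow {A : NE G} {g : G} (hg : g ∈ (A : Finset G)) (m : ℕ) :
    g ^ m ∈ ((A ^ m : NE G) : Finset G) := by
  rw [SubmonoidClass.coe_pow]
  exact Finset.pow_mem_pow hg

theorem pow_eq_of_idempotent {M : Type*} [Monoid M] {a : M} (h : a * a = a) {k : ℕ} (hk : 1 ≤ k) :
    a ^ k = a := by
  induction k, hk using Nat.le_induction with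
  | base => exact pow_one a
  | succ n _ ih => rw [pow_succ, ih, h]

theorem mul_self_of_coe_eq {A : NE G} {N : Subgroup G} (h : ((A : Finset G) : Set G) = N) :
    A * A = A := by
  have hmem : ∀ x, x ∈ (A : Finset G) ↔ x ∈ N := fun x => by
    rw [← Finset.mem_coe, h, SetLike.mem_coe]
  refine Subtype.ext (Finset.ext fun x => ?_)
  rw [mem_mul_iff, hmem]
  constructor
  · rintro ⟨a, ha, b, hb, rfl⟩
    exact N.mul_mem ((hmem a).1 ha) ((hmem b).1 hb)
  · exact fun hx => ⟨1, (hmem 1).2 N.one_mem, x, (hmem x).2 hx, one_mul x⟩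

/-- Both powers are idempotent, so each equals `A ^ (m * m')`. -/
theorem IsPowerSubgroup.unique {A : NE G} {N N' : Subgroup G} (h : IsPowerSubgroup A N)
    (h' : IsPowerSubgroup A N') : N = N' := by
  obtain ⟨m, hm, h⟩ := h
  obtain ⟨m', hm', h'⟩ := h'
  have e : A ^ m = A ^ m' := by
    rw [← pow_eq_of_idempotent (mul_self_of_coe_eq h) hm', ← pow_mul, mul_comm, pow_mul,
      pow_eq_of_idempotent (mul_self_of_coe_eq h') hm]
  exact SetLike.coe_injective (by rw [← h, ← h', e])

/-- For `m = k + 1`, both `g ^ (k + 1)` and `g ^ k * x` lie in `A ^ m = N`, and their quotient is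
`g⁻¹ * x`. -/
theorem IsPowerSubgroup.inv_mul_mem {A : NE G} {N : Subgroup G} (h : IsPowerSubgroup A N) {g x : G}
    (hg : g ∈ (A : Finset G)) (hx : x ∈ (A : Finset G)) : g⁻¹ * x ∈ N := by
  obtain ⟨m, hm, h⟩ := h
  obtain ⟨k, rfl⟩ := Nat.exists_eq_add_of_le' hm
  have hmem : ∀ y, y ∈ ((A ^ (k + 1) : NE G) : Finset G) → y ∈ N := fun y hy => by
    rw [← SetLike.mem_coe, ← h]
    exact hy
  have h1 := hmem _ (pow_mem_pow hg (k + 1))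
  have h2 : g ^ k * x ∈ N := hmem _ (by
    rw [pow_succ]
    exact mem_mul_iff.2 ⟨_, pow_mem_pow hg k, x, hx, rfl⟩)
  have h3 := N.mul_mem (N.inv_mem h1) h2
  rwa [show (g ^ (k + 1))⁻¹ * (g ^ k * x) = g⁻¹ * x by rw [pow_succ]; group] at h3

variable [Finite G]

instance : Finite (NE G) := Subtype.finite

theorem mem_coset {g x : G} {N : Subgroup G} : x ∈ (coset g N : Finset G) ↔ g⁻¹ * x ∈ N := by
  unfold coset
  rw [Set.Finite.mem_toFinset, Set.mem_smul_set_iff_inv_smul_mem, smul_eq_mul, SetLike.mem_coe]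

theorem self_mem_coset (g : G) (N : Subgroup G) : g ∈ (coset g N : Finset G) := by
  rw [mem_coset, inv_mul_cancel]
  exact N.one_mem

theorem coset_eq_of_mk_eq {g h : G} {N : Subgroup G} (e : (g : G ⧸ N) = h) :
    coset g N = coset h N := by
  refine Subtype.ext (Finset.ext fun x => ?_)
  rw [mem_coset, mem_coset, ← QuotientGroup.eq, ← QuotientGroup.eq, e]

/-- A power of a nonempty subset of a finite group is a subgroup. -/
theorem exists_isPowerSubgroup (A : NE G) : ∃ N : Subgroup G, IsPowerSubgroup A N := by
  -- By pigeonhole the powers of `A` become periodic from some `i` on, with period `p`. A multiple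
  -- of `p` that is at least `i` is the exponent of an idempotent.
  obtain ⟨m, hm, hi⟩ : ∃ m : ℕ, 1 ≤ m ∧ A ^ m * A ^ m = A ^ m := by
    obtain ⟨i, j, hij, e⟩ := Finite.exists_ne_map_eq_of_infinite fun n : ℕ => A ^ n
    wlog hlt : i < j generalizing i j
    · exact this j i hij.symm e.symm (lt_of_le_of_ne (not_lt.1 hlt) hij.symm)
    obtain ⟨p, rfl⟩ := Nat.exists_eq_add_of_le hlt.le
    have hp : 1 ≤ p := by omega
    have hper : ∀ t n, i ≤ n → A ^ (n + t * p) = A ^ n := by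
      intro t
      induction t with
      | zero => simp
      | succ t ih =>
        intro n hn
        obtain ⟨r, rfl⟩ := Nat.exists_eq_add_of_le hn
        rw [show i + r + (t + 1) * p = (i + p) + (r + t * p) by ring, pow_add A (i + p),
          ← show A ^ i = A ^ (i + p) from e, ← pow_add, ← add_assoc, ih _ hn]
    -- The factor `i + 1` instead of `i` keeps the exponent positive when `i = 0`.
    refine ⟨(i + 1) * p, Nat.mul_pos i.succ_pos hp, ?_⟩
    rw [← pow_add, hper]
    exact le_trans (by omega) (Nat.le_mul_of_pos_right (i + 1) hp)
  -- The idempotent `A ^ m` is closed under products; finite orders then supply the unit and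
  -- inverses.
  have hmul : ∀ {a b : G}, a ∈ ((A ^ m : NE G) : Finset G) → b ∈ ((A ^ m : NE G) : Finset G) →
      a * b ∈ ((A ^ m : NE G) : Finset G) := fun ha hb => by
    rw [← hi]
    exact mem_mul_iff.2 ⟨_, ha, _, hb, rfl⟩
  have hpow : ∀ {a : G}, a ∈ ((A ^ m : NE G) : Finset G) → ∀ n : ℕ,
      a ^ (n + 1) ∈ ((A ^ m : NE G) : Finset G) := fun ha n => by
    induction n with
    | zero => simpa using ha
    | succ n ih => rw [pow_succ]; exact hmul ih ha
  have hone : (1 : G) ∈ ((A ^ m : NE G) : Finset G) := by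
    obtain ⟨a, ha⟩ : ((A ^ m : NE G) : Finset G).Nonempty := (A ^ m).2
    have := hpow ha (orderOf a - 1)
    rwa [Nat.sub_add_cancel (orderOf_pos a), pow_orderOf_eq_one] at this
  refine ⟨{ carrier := ((A ^ m : NE G) : Finset G)
            mul_mem' := fun ha hb => hmul ha hb
            one_mem' := hone
            inv_mem' := fun {a} ha => ?_ }, m, hm, rfl⟩
  change a⁻¹ ∈ ((A ^ m : NE G) : Finset G)
  have h1 : a⁻¹ = a ^ (orderOf a - 1) := by
    rw [inv_eq_iff_mul_eq_one, ← pow_succ', Nat.sub_add_cancel (orderOf_pos a),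
      pow_orderOf_eq_one]
  rw [h1]
  -- `hpow` only reaches positive exponents, so the case `orderOf a = 1` is separate.
  rcases Nat.eq_zero_or_pos (orderOf a - 1) with h0 | h0
  · rw [h0, pow_zero]
    exact hone
  · rw [← Nat.sub_add_cancel h0]
    exact hpow ha _

theorem IsPowerSubgroup.subset_coset {A : NE G} {N : Subgroup G} (h : IsPowerSubgroup A N) {g : G}
    (hg : g ∈ (A : Finset G)) : (A : Finset G) ⊆ (coset g N : Finset G) :=
  fun _ hx => mem_coset.2 (h.inv_mul_mem hg hx)

/-- A single `a ∈ A` already fills the whole product, since `a * hN = ghN` for `a ∈ gN`. -/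
theorem mul_coset {A : NE G} {N : Subgroup G} {g : G} (hA : (A : Finset G) ⊆ (coset g N : Finset G))
    (h : G) : A * coset h N = coset (g * h) N := by
  refine Subtype.ext (Finset.ext fun x => ?_)
  rw [mem_mul_iff, mem_coset]
  constructor
  · rintro ⟨a, ha, b, hb, rfl⟩
    have := N.mul_mem (mem_coset.1 (hA ha)) (mem_coset.1 hb)
    rwa [show (g * h)⁻¹ * (a * b) = g⁻¹ * a * (h⁻¹ * b) by
      rw [mul_inv, mul_mul_mul_comm]]
  · intro hx
    obtain ⟨a, ha⟩ : (A : Finset G).Nonempty := A.2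
    refine ⟨a, ha, a⁻¹ * x, mem_coset.2 ?_, mul_inv_cancel_left a x⟩
    have := N.mul_mem (N.inv_mem (mem_coset.1 (hA ha))) hx
    rwa [show (g⁻¹ * a)⁻¹ * ((g * h)⁻¹ * x) = h⁻¹ * (a⁻¹ * x) by
      rw [mul_inv, mul_inv, inv_inv, mul_mul_mul_comm, mul_inv_cancel_left, mul_left_comm]] at this

/-- If `A ^ m = N`, the exponent `m + 1` works: `A * N` and `A ^ m * gN = N * gN` are both `gN`, and
the latter is `(gN) ^ (m + 1)` by `mul_coset`. -/
theorem IsPowerSubgroup.exists_pow_eq {A : NE G} {N : Subgroup G} (h : IsPowerSubgroup A N) {g : G}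
    (hA : (A : Finset G) ⊆ (coset g N : Finset G)) :
    ∃ m : ℕ, 1 ≤ m ∧ A ^ m = coset g N ^ m := by
  have hpow : ∀ m : ℕ, coset g N ^ (m + 1) = A ^ m * coset g N := by
    intro m
    induction m with
    | zero => simp
    | succ m ih =>
      rw [pow_succ, ih, mul_assoc, mul_coset subset_rfl, pow_succ, mul_assoc, mul_coset hA]
  obtain ⟨m, hm, e⟩ := h
  have hN : A ^ m = coset 1 N := Subtype.ext (Finset.ext fun x => by
    rw [mem_coset, inv_one, one_mul, ← Finset.mem_coe, e, SetLike.mem_coe])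
  refine ⟨m + 1, m.succ_pos, ?_⟩
  rw [hpow, hN, pow_succ', hN, mul_coset hA, mul_coset subset_rfl, mul_comm]

end Subsets

/-- The relation makes every mixed product collapse to a power of `y`, whence `(x - y) ^ n = x ^ n -
y ^ n` for `n ≥ 1`. -/
theorem isNilpotent_sub_of_mul_eq {R : Type*} [CommRing R] {x y : R} (h : x * y = y * y) {m : ℕ}
    (hm : 1 ≤ m) (e : x ^ m = y ^ m) : IsNilpotent (x - y) := by
  have hxy : ∀ n : ℕ, x ^ n * y = y ^ n * y := by
    intro n
    induction n with
    | zero => rw [pow_zero, pow_zero]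
    | succ n ih => rw [pow_succ', mul_assoc, ih, mul_left_comm, h, pow_succ, mul_assoc]
  have key : ∀ n : ℕ, 1 ≤ n → (x - y) ^ n = x ^ n - y ^ n := by
    intro n hn
    induction n, hn using Nat.le_induction with
    | base => simp
    | succ n _ ih =>
      have h2 : y ^ n * x = y ^ n * y := by
        obtain ⟨k, rfl⟩ := Nat.exists_eq_add_of_le' ‹1 ≤ n›
        rw [pow_succ, mul_assoc, mul_comm y x, h, mul_assoc]
      rw [pow_succ, ih, mul_sub, sub_mul, sub_mul, hxy, h2, pow_succ, pow_succ]
      ring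
  exact ⟨m, by rw [key m hm, e, sub_self]⟩

/-! ### The splitting of the chain algebra and the nilpotent ideal -/

section Chain

variable {G H : Type*} [CommGroup G] [CommGroup H] [DecidableEq G] [DecidableEq H]
variable (k : Type*) [CommRing k] (π : G →* H)

theorem toProd_comp_ofProd (p : SubsetAlgebra k G × SubsetAlgebra k H) :
    toProd k π (ofProd k π p) = p := by
  have hr : ∀ y : SubsetAlgebra k H, toProd k π (ofProd k π (0, y)) = (0, y) := by
    intro y
    induction y using MonoidAlgebra.induction_linear with
    | zero => rw [show ((0, 0) : SubsetAlgebra k G × SubsetAlgebra k H) = 0 from rfl, map_zero,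
        map_zero]
    | add y z hy hz =>
      rw [show ((0, y + z) : SubsetAlgebra k G × SubsetAlgebra k H) = (0, y) + (0, z) by simp,
        map_add, map_add, hy, hz]
    | single B c =>
      rw [show ((0, MonoidAlgebra.single B c) : SubsetAlgebra k G × SubsetAlgebra k H) =
        c • (0, MonoidAlgebra.single B 1) by simp, map_smul, map_smul, ofProd_snd, toProd_short]
  have hl : ∀ x : SubsetAlgebra k G, toProd k π (ofProd k π (x, 0)) = (x, 0) := by
    intro x
    induction x using MonoidAlgebra.induction_linear with
    | zero => rw [show ((0, 0) : SubsetAlgebra k G × SubsetAlgebra k H) = 0 from rfl, map_zero,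
        map_zero]
    | add y z hy hz =>
      rw [show ((y + z, 0) : SubsetAlgebra k G × SubsetAlgebra k H) = (y, 0) + (z, 0) by simp,
        map_add, map_add, hy, hz]
    | single A c =>
      rw [show ((MonoidAlgebra.single A c, 0) : SubsetAlgebra k G × SubsetAlgebra k H) =
        c • (MonoidAlgebra.single A 1, 0) by simp, map_smul, map_smul, ofProd_single, ← Prod.zero_eq_mk,
        map_zero, add_zero, map_sub, ← ofProd_pointSum, hr, toProd_long]
      simp
  rw [show p = (p.1, 0) + (0, p.2) by simp, map_add, map_add, hl, hr]

/-- The algebra of the chain is the product of the algebras of subsets of `G` and of `H`. -/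
noncomputable def prodEquiv : ChainAlgebra k π ≃+* SubsetAlgebra k G × SubsetAlgebra k H where
  toFun := toProd k π
  invFun := ofProd k π
  left_inv x := LinearMap.congr_fun (ofProd_comp_toProd k π) x
  right_inv := toProd_comp_ofProd k π
  map_mul' := toProd_mul k π
  map_add' := map_add _

theorem prodEquiv_apply (x : ChainAlgebra k π) : prodEquiv k π x = toProd k π x := rfl

/-- This identifies multiplication by `1 - e` with projection to the first factor. -/
theorem prodEquiv_one_sub : prodEquiv k π (1 - short k π 1) = (1, 0) := by
  rw [map_sub, map_one, prodEquiv_apply, toProd_short]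
  ext1
  · exact sub_zero _
  · exact sub_self _

theorem proj_apply (x : ChainAlgebra k π) : (proj k π x).1 = x * (1 - short k π 1) := rfl

theorem mul_one_sub_of_factor (x : Factor k π) : x.1 * (1 - short k π 1) = x.1 :=
  (Subsemigroup.mem_corner_iff (isIdempotentElem_short_one k π).one_sub).1 x.2 |>.2

/-- The corner of the algebra of the chain is the algebra of subsets of `G`. -/
noncomputable def factorEquiv : Factor k π ≃+* SubsetAlgebra k G where
  toFun x := (prodEquiv k π x.1).1
  invFun y := proj k π ((prodEquiv k π).symm (y, 0))
  left_inv x := by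
    refine Subtype.ext ((prodEquiv k π).injective ?_)
    dsimp only
    rw [proj_apply, map_mul, RingEquiv.apply_symm_apply, prodEquiv_one_sub]
    conv_rhs => rw [← mul_one_sub_of_factor k π x, map_mul, prodEquiv_one_sub]
    ext1 <;> simp
  right_inv y := by
    dsimp only
    rw [proj_apply, map_mul, RingEquiv.apply_symm_apply, prodEquiv_one_sub]
    simp
  map_mul' x y := by
    change (prodEquiv k π (x.1 * y.1)).1 = _
    rw [map_mul, Prod.fst_mul]
  map_add' x y := by
    change (prodEquiv k π (x.1 + y.1)).1 = _
    rw [map_add, Prod.fst_add]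

theorem factorEquiv_proj (x : ChainAlgebra k π) :
    factorEquiv k π (proj k π x) = (prodEquiv k π x).1 := by
  change (prodEquiv k π (x * (1 - short k π 1))).1 = _
  rw [map_mul, prodEquiv_one_sub, Prod.fst_mul, mul_one]

theorem factorEquiv_proj_long (A : NE G) :
    factorEquiv k π (proj k π (long k π A)) = MonoidAlgebra.single A 1 := by
  rw [factorEquiv_proj, prodEquiv_apply, toProd_long]

theorem proj_long (A : NE G) : (proj k π (long k π A)).1 =
    long k π A - ∑ h ∈ (A : Finset G).image π, short k π (pt h) := by
  rw [proj_apply, mul_sub, mul_one, long_mul_short]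
  simp only [mul_one]

/-- The splitting of the algebra of the chain. -/
noncomputable def splitting : ChainAlgebra k π ≃+* Factor k π × SubsetAlgebra k H :=
  (prodEquiv k π).trans ((factorEquiv k π).symm.prodCongr (RingEquiv.refl _))

theorem splitting_apply (x : ChainAlgebra k π) :
    splitting k π x = (proj k π x, (toProd k π x).2) := by
  refine Prod.ext ?_ rfl
  change (factorEquiv k π).symm (prodEquiv k π x).1 = _
  rw [← factorEquiv_proj, RingEquiv.symm_apply_apply]

theorem isNilpotent_single_sub [Finite G] {A : NE G} {N : Subgroup G} {g : G}
    (h : IsPowerSubgroup A N) (hA : (A : Finset G) ⊆ (coset g N : Finset G)) :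
    IsNilpotent (MonoidAlgebra.single A 1 - MonoidAlgebra.single (coset g N) 1 :
      SubsetAlgebra k G) := by
  obtain ⟨m, hm, e⟩ := h.exists_pow_eq hA
  refine isNilpotent_sub_of_mul_eq ?_ hm ?_
  · rw [MonoidAlgebra.single_mul_single, MonoidAlgebra.single_mul_single, mul_coset hA,
      mul_coset subset_rfl]
  · rw [MonoidAlgebra.single_pow, MonoidAlgebra.single_pow, e]

theorem isNilpotent_proj_sub [Finite G] {A : NE G} {N : Subgroup G} {g : G}
    (h : IsPowerSubgroup A N) (hA : (A : Finset G) ⊆ (coset g N : Finset G)) :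
    IsNilpotent (proj k π (long k π A) - proj k π (long k π (coset g N))) := by
  rw [← IsNilpotent.map_iff (factorEquiv k π).injective, map_sub, factorEquiv_proj_long,
    factorEquiv_proj_long]
  exact isNilpotent_single_sub k h hA

/-- There are finitely many generators because `NE G` is finite, and a finitely generated ideal
inside the nilradical is nilpotent. -/
theorem isNilpotent_nilIdeal [Finite G] : IsNilpotent (nilIdeal k π) := by
  have hfin : {x | ∃ (A : NE G) (N : Subgroup G) (g : G), IsPowerSubgroup A N ∧
      (A : Finset G) ⊆ (coset g N : Finset G) ∧
      x = proj k π (long k π A) - proj k π (long k π (coset g N))}.Finite := by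
    refine (Set.finite_range fun p : NE G × NE G =>
      proj k π (long k π p.1) - proj k π (long k π p.2)).subset ?_
    rintro _ ⟨A, N, g, _, _, rfl⟩
    exact ⟨(A, coset g N), rfl⟩
  refine (Ideal.FG.isNilpotent_iff_le_nilradical
    (Submodule.fg_span hfin : (nilIdeal k π).FG)).2 (Ideal.span_le.2 ?_)
  rintro _ ⟨A, N, g, h, hA, rfl⟩
  exact isNilpotent_proj_sub k π h hA

end Chain

/-! ### Coset characters and the group algebras `ℚ(G/N)` -/

section Quotients

open Classical in
theorem finprod_atoms {G M : Type*} [CommGroup G] [Finite G] [CommMonoid M] (N : Subgroup G) (F : Subgroup (G ⧸ N) → M) :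
    letI := Fintype.ofFinite (Subgroup (G ⧸ N))
    ∏ᶠ (L : Subgroup (G ⧸ N)) (_ : IsAtom L), F L =
      ∏ L ∈ Finset.univ.filter fun L : Subgroup (G ⧸ N) => IsAtom L, F L := by
  let _ := Fintype.ofFinite (Subgroup (G ⧸ N))
  exact finprod_cond_eq_prod_of_cond_iff F (by simp)

variable {G : Type*} [CommGroup G] [DecidableEq G] [Finite G]

open Classical in
/-- The value of the character of `NE G` with values in `ℚ(G/N)`: a subset of a coset `gN` is sent
to that coset, every other subset to zero. -/
noncomputable def cosetChar (N : Subgroup G) (A : NE G) : MonoidAlgebra ℚ (G ⧸ N) :=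
  if ∃ g, (A : Finset G) ⊆ (coset g N : Finset G) then
    MonoidAlgebra.single (A.2.choose : G ⧸ N) 1 else 0

/-- The element chosen in `cosetChar` is immaterial: all elements of `A` have the same class. -/
theorem cosetChar_of_subset {N : Subgroup G} {A : NE G} {g : G}
    (h : (A : Finset G) ⊆ (coset g N : Finset G)) :
    cosetChar N A = MonoidAlgebra.single (g : G ⧸ N) 1 := by
  rw [cosetChar, if_pos ⟨g, h⟩, QuotientGroup.eq.2 (mem_coset.1 (h A.2.choose_spec))]

theorem cosetChar_of_not {N : Subgroup G} {A : NE G}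
    (h : ¬ ∃ g, (A : Finset G) ⊆ (coset g N : Finset G)) : cosetChar N A = 0 :=
  if_neg h

theorem coset_subset_coset {K N : Subgroup G} (h : K ≤ N) (g : G) :
    (coset g K : Finset G) ⊆ (coset g N : Finset G) :=
  fun _ hx => mem_coset.2 (h (mem_coset.1 hx))

theorem le_of_coset_subset {K N : Subgroup G} {g g' : G}
    (h : (coset g K : Finset G) ⊆ (coset g' N : Finset G)) : K ≤ N := fun x hx => by
  have h1 := mem_coset.1 (h (self_mem_coset g K))
  have h2 := mem_coset.1 (h (mem_coset.2 (by simpa using hx) : g * x ∈ (coset g K : Finset G)))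
  have := N.mul_mem (N.inv_mem h1) h2
  rwa [show (g'⁻¹ * g)⁻¹ * (g'⁻¹ * (g * x)) = x by group] at this

theorem cosetChar_one (N : Subgroup G) : cosetChar N 1 = 1 := by
  rw [cosetChar_of_subset (g := 1), QuotientGroup.mk_one, MonoidAlgebra.one_def]
  intro x hx
  rw [Submonoid.coe_one, Finset.mem_one] at hx
  rw [hx]
  exact self_mem_coset 1 N

/-- Zero values cause no trouble: if `A * B` lies in one coset, so does its translate `A * b * b⁻¹`,
hence `A`, and by commutativity also `B`. -/
theorem cosetChar_mul (N : Subgroup G) (A B : NE G) :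
    cosetChar N (A * B) = cosetChar N A * cosetChar N B := by
  have left : ∀ A B : NE G, (∃ g, ((A * B : NE G) : Finset G) ⊆ (coset g N : Finset G)) →
      ∃ g, (A : Finset G) ⊆ (coset g N : Finset G) := by
    rintro A B ⟨g, h⟩
    obtain ⟨b, hb⟩ : (B : Finset G).Nonempty := B.2
    refine ⟨g * b⁻¹, fun a ha => mem_coset.2 ?_⟩
    have := mem_coset.1 (h (mem_mul_iff.2 ⟨a, ha, b, hb, rfl⟩))
    rwa [show (g * b⁻¹)⁻¹ * a = g⁻¹ * (a * b) by
      rw [mul_inv, inv_inv, mul_assoc, mul_comm b a]]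
  by_cases hA : ∃ g, (A : Finset G) ⊆ (coset g N : Finset G)
  · by_cases hB : ∃ g, (B : Finset G) ⊆ (coset g N : Finset G)
    · obtain ⟨g, hg⟩ := hA
      obtain ⟨h, hh⟩ := hB
      rw [cosetChar_of_subset hg, cosetChar_of_subset hh, MonoidAlgebra.single_mul_single, mul_one,
        ← QuotientGroup.mk_mul]
      refine cosetChar_of_subset fun x hx => ?_
      rw [← mul_coset hg h]
      obtain ⟨a, ha, b, hb, rfl⟩ := mem_mul_iff.1 hx
      exact mem_mul_iff.2 ⟨a, ha, b, hh hb, rfl⟩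
    · rw [cosetChar_of_not hB, mul_zero]
      exact cosetChar_of_not fun h => hB (left B A (by rwa [mul_comm]))
  · rw [cosetChar_of_not hA, zero_mul]
    exact cosetChar_of_not fun h => hA (left A B h)

open Classical in
-- On subgroups the characters are the incidence function of the subgroup lattice, which makes the
-- products for `e_N` computable.
theorem cosetChar_coset (N K : Subgroup G) :
    cosetChar N (coset 1 K) = if K ≤ N then 1 else 0 := by
  split_ifs with h
  · rw [cosetChar_of_subset (coset_subset_coset h 1), QuotientGroup.mk_one, MonoidAlgebra.one_def]
  · exact cosetChar_of_not fun ⟨_, hg⟩ => h (le_of_coset_subset hg)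

/-- The homomorphism `ℚ(G̃) → ⨁ ℚ(G/N)` with components the characters `cosetChar N`. -/
noncomputable def toQuotients : SubsetAlgebra ℚ G →ₐ[ℚ] SumQuotients G :=
  AlgHom.pi fun N => MonoidAlgebra.lift ℚ (MonoidAlgebra ℚ (G ⧸ N)) (NE G)
    { toFun := cosetChar N
      map_one' := cosetChar_one N
      map_mul' := cosetChar_mul N }

theorem toQuotients_single (A : NE G) (N : Subgroup G) :
    toQuotients (MonoidAlgebra.single A 1) N = cosetChar N A := by
  simp [toQuotients, MonoidAlgebra.lift_single]

variable (G) in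
/-- The image of the nil ideal in the algebra of subsets of `G`. -/
noncomputable def subsetNilIdeal : Ideal (SubsetAlgebra ℚ G) :=
  Ideal.span {x | ∃ (A : NE G) (N : Subgroup G) (g : G), IsPowerSubgroup A N ∧
    (A : Finset G) ⊆ (coset g N : Finset G) ∧
    x = MonoidAlgebra.single A 1 - MonoidAlgebra.single (coset g N) 1}

/-- This is why the characters kill the generators of `I`. From `A ⊆ hK` follows `N = A ^ m ⊆ h ^ m
K`; as `1 ∈ N`, this forces `N ≤ K`, and `gN`, which meets `hK` in `A`, lies in `hK`. -/
theorem IsPowerSubgroup.subset_coset_iff {A : NE G} {N K : Subgroup G} {g h : G}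
    (hN : IsPowerSubgroup A N) (hA : (A : Finset G) ⊆ (coset g N : Finset G)) :
    (A : Finset G) ⊆ (coset h K : Finset G) ↔ (coset g N : Finset G) ⊆ (coset h K : Finset G) := by
  refine ⟨fun hK => ?_, hA.trans⟩
  obtain ⟨m, hm, e⟩ := hN
  have hNK : N ≤ K := by
    have hpow : ∀ n : ℕ, ∀ x ∈ ((A ^ n : NE G) : Finset G), (h ^ n)⁻¹ * x ∈ K := by
      intro n
      induction n with
      | zero =>
        intro x hx
        rw [pow_zero, Submonoid.coe_one, Finset.mem_one] at hx
        rw [hx]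
        simp
      | succ n ih =>
        intro x hx
        rw [pow_succ] at hx
        obtain ⟨a, ha, b, hb, rfl⟩ := mem_mul_iff.1 hx
        have := K.mul_mem (ih a ha) (mem_coset.1 (hK hb))
        rwa [pow_succ, mul_inv, mul_mul_mul_comm]
    have hpow' : ∀ x ∈ N, (h ^ m)⁻¹ * x ∈ K := fun x hx => hpow m x (by
      rw [← Finset.mem_coe, e]
      exact hx)
    intro x hx
    have := K.mul_mem (K.inv_mem (hpow' 1 N.one_mem)) (hpow' x hx)
    rwa [mul_one, inv_inv, mul_inv_cancel_left] at this
  obtain ⟨a, ha⟩ : (A : Finset G).Nonempty := A.2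
  intro x hx
  have h1 := hNK (N.mul_mem (N.inv_mem (mem_coset.1 (hA ha))) (mem_coset.1 hx))
  have := K.mul_mem (mem_coset.1 (hK ha)) h1
  rw [mem_coset]
  rwa [show h⁻¹ * a * ((g⁻¹ * a)⁻¹ * (g⁻¹ * x)) = h⁻¹ * x by group] at this

theorem toQuotients_eq_zero_of_mem (x : SubsetAlgebra ℚ G) (hx : x ∈ subsetNilIdeal G) :
    toQuotients x = 0 := by
  have : subsetNilIdeal G ≤ RingHom.ker (toQuotients (G := G)).toRingHom := by
    refine Ideal.span_le.2 ?_
    rintro _ ⟨A, N, g, hN, hA, rfl⟩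
    change toQuotients _ = 0
    rw [map_sub, sub_eq_zero]
    funext K
    rw [toQuotients_single, toQuotients_single]
    by_cases h : ∃ h, (A : Finset G) ⊆ (coset h K : Finset G)
    · obtain ⟨h, hh⟩ := h
      rw [cosetChar_of_subset hh, cosetChar_of_subset ((hN.subset_coset_iff hA).1 hh)]
    · rw [cosetChar_of_not h, cosetChar_of_not fun ⟨h', hh⟩ => h ⟨h', hA.trans hh⟩]
  exact this hx

/-- The homomorphism `ℚ(G̃)/I → ⨁ ℚ(G/N)`. -/
noncomputable def quotientHom : (SubsetAlgebra ℚ G ⧸ subsetNilIdeal G) →ₐ[ℚ] SumQuotients G :=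
  Ideal.Quotient.liftₐ (subsetNilIdeal G) toQuotients toQuotients_eq_zero_of_mem

theorem quotientHom_mk (x : SubsetAlgebra ℚ G) :
    quotientHom (Ideal.Quotient.mk (subsetNilIdeal G) x) = toQuotients x := rfl

/-- The factor for `N'` has `K`-component `[N ≤ K] - [N' ≤ K]`. All factors are `1` at `K = N`; some
factor vanishes at every other `K`. -/
theorem toQuotients_finprod (N : Subgroup G) (hN : N ≠ ⊤) :
    toQuotients (∏ᶠ (L : Subgroup (G ⧸ N)) (_ : IsAtom L),
      (MonoidAlgebra.single (coset 1 N) 1 -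
        MonoidAlgebra.single (coset 1 (L.comap (QuotientGroup.mk' N))) 1)) = unitAt N := by
  classical
  let _ := Fintype.ofFinite (Subgroup (G ⧸ N))
  rw [finprod_atoms, map_prod]
  funext K
  rw [Finset.prod_apply]
  simp only [map_sub, Pi.sub_apply, toQuotients_single, cosetChar_coset]
  have hcomap : ∀ L : Subgroup (G ⧸ N), N ≤ L.comap (QuotientGroup.mk' N) := fun L x hx => by
    rw [Subgroup.mem_comap, QuotientGroup.mk'_apply, (QuotientGroup.eq_one_iff x).2 hx]
    exact L.one_mem
  unfold unitAt
  by_cases hK : N = K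
  · subst hK
    rw [Pi.single_eq_same]
    refine Finset.prod_eq_one fun L hL => ?_
    rw [if_pos le_rfl, if_neg, sub_zero]
    intro h
    refine (Finset.mem_filter.1 hL).2.1 ((Subgroup.eq_bot_iff_forall L).2 fun q hq => ?_)
    obtain ⟨x, rfl⟩ := QuotientGroup.mk_surjective q
    exact (QuotientGroup.eq_one_iff x).2 (h hq)
  · rw [Pi.single_eq_of_ne (Ne.symm hK)]
    by_cases hle : N ≤ K
    · have hne : K.map (QuotientGroup.mk' N) ≠ ⊥ := fun h => hK (le_antisymm hle fun x hx => by
        have := (Subgroup.eq_bot_iff_forall _).1 h _ (Subgroup.mem_map_of_mem _ hx)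
        exact (QuotientGroup.eq_one_iff x).1 this)
      -- For `N < K`, an atom below `K/N` gives a vanishing factor.
      obtain ⟨L, hL, hLK⟩ := (eq_bot_or_exists_atom_le (K.map (QuotientGroup.mk' N))).resolve_left hne
      refine Finset.prod_eq_zero (Finset.mem_filter.2 ⟨Finset.mem_univ L, hL⟩) ?_
      rw [if_pos hle, if_pos, sub_self]
      intro x hx
      obtain ⟨y, hy, e⟩ := Subgroup.mem_map.1 (hLK (Subgroup.mem_comap.1 hx))
      have := K.mul_mem hy (hle (QuotientGroup.eq.1 e))
      rwa [mul_inv_cancel_left] at this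
    -- For `N ≰ K` every factor vanishes, but one must exist: this is where `N ≠ ⊤` enters, as the
    -- empty product is `1`.
    · have hne : (⊤ : Subgroup (G ⧸ N)) ≠ ⊥ := fun h => hN ((Subgroup.eq_top_iff' N).2 fun x =>
        (QuotientGroup.eq_one_iff x).1 ((Subgroup.eq_bot_iff_forall _).1 h _ (Subgroup.mem_top _)))
      obtain ⟨L, hL, -⟩ := (eq_bot_or_exists_atom_le (⊤ : Subgroup (G ⧸ N))).resolve_left hne
      refine Finset.prod_eq_zero (Finset.mem_filter.2 ⟨Finset.mem_univ L, hL⟩) ?_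
      rw [if_neg hle, if_neg fun h => hle ((hcomap L).trans h), sub_self]

theorem toQuotients_top :
    toQuotients (MonoidAlgebra.single (coset 1 (⊤ : Subgroup G)) 1) = unitAt ⊤ := by
  classical
  funext K
  rw [toQuotients_single, cosetChar_coset]
  unfold unitAt
  by_cases h : K = ⊤
  · subst h
    rw [if_pos le_rfl, Pi.single_eq_same]
  · rw [if_neg fun h' => h (top_le_iff.1 h'), Pi.single_eq_of_ne h]

theorem exists_toQuotients_eq_unitAt (N : Subgroup G) : ∃ x, toQuotients x = unitAt N := by
  by_cases h : N = ⊤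
  · exact h ▸ ⟨_, toQuotients_top⟩
  · exact ⟨_, toQuotients_finprod N h⟩

theorem toQuotients_surjective : Function.Surjective (toQuotients (G := G)) := by
  classical
  let _ := Fintype.ofFinite (Subgroup G)
  have key : ∀ (N : Subgroup G) (z : MonoidAlgebra ℚ (G ⧸ N)),
      (Pi.single N z : SumQuotients G) ∈ (toQuotients (G := G)).range := by
    intro N z
    induction z using MonoidAlgebra.induction_linear with
    | zero => rw [Pi.single_zero]; exact zero_mem _
    | add x y hx hy => rw [Pi.single_add]; exact add_mem hx hy
    | single q c =>
      obtain ⟨g, rfl⟩ := QuotientGroup.mk_surjective q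
      obtain ⟨x, hx⟩ := exists_toQuotients_eq_unitAt N
      -- The point `g` maps to its coset in every component; the factor `x`, a preimage of `e_N`,
      -- isolates the component at `N`.
      refine ⟨c • (MonoidAlgebra.single (pt g) 1 * x), ?_⟩
      change toQuotients _ = _
      rw [map_smul, map_mul, hx]
      funext K
      rw [Pi.smul_apply, Pi.mul_apply, toQuotients_single]
      unfold unitAt
      by_cases hK : K = N
      · subst hK
        have : ((pt g : NE G) : Finset G) ⊆ (coset g K : Finset G) :=
          Finset.singleton_subset_iff.2 (self_mem_coset g K)
        rw [Pi.single_eq_same, Pi.single_eq_same, cosetChar_of_subset this, mul_one,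
          MonoidAlgebra.smul_single, smul_eq_mul, mul_one]
      · rw [Pi.single_eq_of_ne hK, Pi.single_eq_of_ne hK, mul_zero, smul_zero]
  intro y
  change y ∈ (toQuotients (G := G)).range
  rw [← Finset.univ_sum_single y]
  exact sum_mem fun N _ => key N _

open Classical in
/-- The linear map `⨁ ℚ(G/N) → ℚ(G̃)/I` that sends a coset to its class. -/
noncomputable def cosetLin : SumQuotients G →ₗ[ℚ] SubsetAlgebra ℚ G ⧸ subsetNilIdeal G :=
  let _ := Fintype.ofFinite (Subgroup G)
  LinearMap.lsum ℚ (fun N : Subgroup G => MonoidAlgebra ℚ (G ⧸ N)) ℚ fun N =>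
    Finsupp.linearCombination ℚ (fun q : G ⧸ N => Ideal.Quotient.mk (subsetNilIdeal G)
      (MonoidAlgebra.single (coset q.out N) 1)) ∘ₗ (MonoidAlgebra.coeffLinearEquiv ℚ).toLinearMap

open Classical in
theorem cosetLin_single (N : Subgroup G) (g : G) :
    cosetLin (Pi.single N (MonoidAlgebra.single (g : G ⧸ N) 1)) =
      Ideal.Quotient.mk (subsetNilIdeal G) (MonoidAlgebra.single (coset g N) 1) := by
  let _ := Fintype.ofFinite (Subgroup G)
  unfold cosetLin
  rw [LinearMap.lsum_piSingle]
  simp only [LinearMap.comp_apply, LinearEquiv.coe_coe, MonoidAlgebra.coeffLinearEquiv_apply,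
    MonoidAlgebra.coeff_single, Finsupp.linearCombination_single, one_smul]
  rw [coset_eq_of_mk_eq (QuotientGroup.out_eq' (g : G ⧸ N))]

/-- Modulo `I` every `A` equals the coset `g n(A)`, so cosets span. -/
theorem cosetLin_surjective : Function.Surjective (cosetLin (G := G)) := by
  classical
  intro z
  obtain ⟨x, rfl⟩ := Ideal.Quotient.mk_surjective z
  change _ ∈ LinearMap.range cosetLin
  induction x using MonoidAlgebra.induction_linear with
  | zero => rw [map_zero]; exact zero_mem _
  | add x y hx hy => rw [map_add]; exact add_mem hx hy
  | single A c =>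
    obtain ⟨N, hN⟩ := exists_isPowerSubgroup A
    obtain ⟨g, hg⟩ : (A : Finset G).Nonempty := A.2
    have e : Ideal.Quotient.mk (subsetNilIdeal G) (MonoidAlgebra.single A 1) =
        Ideal.Quotient.mk (subsetNilIdeal G) (MonoidAlgebra.single (coset g N) 1) :=
      Ideal.Quotient.eq.2 (Ideal.subset_span ⟨A, N, g, hN, hN.subset_coset hg, rfl⟩)
    refine ⟨c • Pi.single N (MonoidAlgebra.single (g : G ⧸ N) 1), ?_⟩
    rw [map_smul, cosetLin_single, ← e]
    change Ideal.Quotient.mk (subsetNilIdeal G) (c • MonoidAlgebra.single A 1) = _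
    rw [MonoidAlgebra.smul_single, smul_eq_mul, mul_one]

/-- `quotientHom ∘ cosetLin` is not the identity, since `gN` has a nonzero component at every `K ≥
N`. It is however a surjective endomorphism of a finite-dimensional space, hence injective; as
`cosetLin` is onto, `quotientHom` is injective too. -/
theorem quotientHom_bijective : Function.Bijective (quotientHom (G := G)) := by
  have hs : Function.Surjective (quotientHom (G := G)) := fun y => by
    obtain ⟨x, rfl⟩ := toQuotients_surjective y
    exact ⟨_, quotientHom_mk x⟩
  refine ⟨?_, hs⟩
  have : ∀ N : Subgroup G, Module.Finite ℚ (MonoidAlgebra ℚ (G ⧸ N)) := fun N =>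
    Module.Finite.equiv (MonoidAlgebra.coeffLinearEquiv (M := G ⧸ N) (S := ℚ) ℚ).symm
  have hi : Function.Injective ((quotientHom (G := G)).toLinearMap ∘ₗ cosetLin (G := G)) :=
    LinearMap.injective_iff_surjective.2 (hs.comp cosetLin_surjective)
  intro x y e
  obtain ⟨x, rfl⟩ := cosetLin_surjective x
  obtain ⟨y, rfl⟩ := cosetLin_surjective y
  exact congrArg cosetLin (hi e)

variable {H : Type*} [CommGroup H] [DecidableEq H] (π : G →* H)

theorem subsetNilIdeal_eq_map :
    subsetNilIdeal G = (nilIdeal ℚ π).map (factorEquiv ℚ π : Factor ℚ π →+* SubsetAlgebra ℚ G) := by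
  rw [nilIdeal, Ideal.map_span, subsetNilIdeal]
  congr 1
  ext x
  constructor
  · rintro ⟨A, N, g, h, hA, rfl⟩
    refine ⟨_, ⟨A, N, g, h, hA, rfl⟩, ?_⟩
    rw [map_sub]
    exact congrArg₂ (· - ·) (factorEquiv_proj_long ℚ π A) (factorEquiv_proj_long ℚ π (coset g N))
  · rintro ⟨_, ⟨A, N, g, h, hA, rfl⟩, rfl⟩
    refine ⟨A, N, g, h, hA, ?_⟩
    rw [map_sub]
    exact congrArg₂ (· - ·) (factorEquiv_proj_long ℚ π A) (factorEquiv_proj_long ℚ π (coset g N))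

/-- The isomorphism `T/I ≃ ⨁ ℚ(G/N)`. -/
noncomputable def factorQuotientEquiv : (Factor ℚ π ⧸ nilIdeal ℚ π) ≃+* SumQuotients G :=
  (Ideal.quotientEquiv (nilIdeal ℚ π) (subsetNilIdeal G) (factorEquiv ℚ π)
    (subsetNilIdeal_eq_map π)).trans
      (AlgEquiv.ofBijective (quotientHom (G := G)) quotientHom_bijective).toRingEquiv

theorem factorQuotientEquiv_mk (x : Factor ℚ π) :
    factorQuotientEquiv π (Ideal.Quotient.mk (nilIdeal ℚ π) x) =
      toQuotients (factorEquiv ℚ π x) := rfl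

theorem factorEquiv_finprod (N : Subgroup G) :
    factorEquiv ℚ π (∏ᶠ (L : Subgroup (G ⧸ N)) (_ : IsAtom L),
      (proj ℚ π (long ℚ π (coset 1 N)) -
        proj ℚ π (long ℚ π (coset 1 (L.comap (QuotientGroup.mk' N)))))) =
    ∏ᶠ (L : Subgroup (G ⧸ N)) (_ : IsAtom L), (MonoidAlgebra.single (coset 1 N) 1 -
      MonoidAlgebra.single (coset 1 (L.comap (QuotientGroup.mk' N))) 1) := by
  classical
  let _ := Fintype.ofFinite (Subgroup (G ⧸ N))
  rw [finprod_atoms, finprod_atoms, map_prod]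
  simp only [map_sub, factorEquiv_proj_long]

end Quotients

end Glider

/-! ### Assembly of the theorem -/

theorem mainTheorem8 {G : Type*} [CommGroup G] [Finite G] [DecidableEq G] (H : Subgroup G)
    (φ : G ≃* (G →* ℂˣ)) (ψ : H ≃* (H →* ℂˣ)) (π : G →* H)
    (hπ : π = Glider.restrictionMap H φ ψ) :
    -- the splitting `ℚ(H < G) ≃ ℚ(H < G)(1 - χ_(∅,{1})) × ℚ(H̃)`
    (∃ Φ : Glider.ChainAlgebra ℚ π ≃+* Glider.Factor ℚ π × Glider.SubsetAlgebra ℚ H,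
      (∀ A : Glider.NE G,
        (Φ (Glider.long ℚ π A)).1.1 =
          Glider.long ℚ π A -
            ∑ h ∈ (A : Finset G).image π, Glider.short ℚ π (Glider.pt h) ∧
        (Φ (Glider.long ℚ π A)).2 =
          ∑ h ∈ (A : Finset G).image π, MonoidAlgebra.single (Glider.pt h) (1 : ℚ)) ∧
      (∀ B : Glider.NE H, Φ (Glider.short ℚ π B) = (0, MonoidAlgebra.single B (1 : ℚ))) ∧
      (∀ x : Glider.ChainAlgebra ℚ π, (Φ x).1 = Glider.proj ℚ π x)) ∧
    -- every `n(A)` exists, and the generators of `I` are nilpotent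
    (∀ A : Glider.NE G, ∃! N : Subgroup G, Glider.IsPowerSubgroup A N) ∧
    (∀ (A : Glider.NE G) (N : Subgroup G), Glider.IsPowerSubgroup A N →
      ∀ g ∈ (A : Finset G), (A : Finset G) ⊆ (Glider.coset g N : Finset G) ∧
        IsNilpotent (Glider.proj ℚ π (Glider.long ℚ π A) -
          Glider.proj ℚ π (Glider.long ℚ π (Glider.coset g N)))) ∧
    -- `I` is nilpotent
    IsNilpotent (Glider.nilIdeal ℚ π) ∧
    -- the isomorphism `⨁_{N ≤ G} ℚ(G/N) ≃ ℚ(H < G)(1 - χ_(∅,{1})) / I`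
    (∃ Θ : Glider.SumQuotients G ≃+*
        Glider.Factor ℚ π ⧸ Glider.nilIdeal ℚ π,
      (∀ N : Subgroup G, N ≠ ⊤ →
        Θ (Glider.unitAt N) = Ideal.Quotient.mk (Glider.nilIdeal ℚ π)
          (∏ᶠ (L : Subgroup (G ⧸ N)) (_ : IsAtom L),
            (Glider.proj ℚ π (Glider.long ℚ π (Glider.coset 1 N)) -
              Glider.proj ℚ π (Glider.long ℚ π
                (Glider.coset 1 (L.comap (QuotientGroup.mk' N))))))) ∧
      Θ (Glider.unitAt ⊤) = Ideal.Quotient.mk (Glider.nilIdeal ℚ π)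
        (Glider.proj ℚ π (Glider.long ℚ π (Glider.coset 1 ⊤)))) := by
  refine ⟨⟨Glider.splitting ℚ π, fun A => ?_, fun B => ?_, fun x => ?_⟩, fun A => ?_,
    fun A N hN g hg => ?_, Glider.isNilpotent_nilIdeal ℚ π,
    (Glider.factorQuotientEquiv π).symm, fun N hN => ?_, ?_⟩
  · rw [Glider.splitting_apply, Glider.toProd_long]
    exact ⟨Glider.proj_long ℚ π A, rfl⟩
  · rw [Glider.splitting_apply, Glider.toProd_short]
    refine Prod.ext (Subtype.ext ?_) rfl
    -- `e` acts as the identity on the elements `χ_(∅,B)`, so `1 - e` kills them.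
    change Glider.short ℚ π B * (1 - Glider.short ℚ π 1) = 0
    rw [mul_sub, mul_one, Glider.short_mul_short, mul_one, sub_self]
  · rw [Glider.splitting_apply]
  · obtain ⟨N, hN⟩ := Glider.exists_isPowerSubgroup A
    exact ⟨N, hN, fun N' hN' => hN'.unique hN⟩
  · exact ⟨hN.subset_coset hg, Glider.isNilpotent_proj_sub ℚ π hN (hN.subset_coset hg)⟩
  -- The formulas for the unit elements are checked after applying the inverse of `Θ`, inside `⨁
  -- ℚ(G/N)`.
  · rw [RingEquiv.symm_apply_eq, Glider.factorQuotientEquiv_mk, Glider.factorEquiv_finprod,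
      Glider.toQuotients_finprod N hN]
  · rw [RingEquiv.symm_apply_eq, Glider.factorQuotientEquiv_mk, Glider.factorEquiv_proj_long,
      Glider.toQuotients_top]
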